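/- Let $M$ and $N$ be smooth compact $d$-dimensional manifolds without boundary, and let $M$ carry a smooth Riemannian metric with volume measure $dx$ and divergence $\mathrm{div}$. Let $\mathrm{Diff}^\ell(M,N)$ be the set of $C^\ell$ diffeomorphisms $M\to N$, $\mathfrak{X}^1(M)$ the space of $C^1$ vector fields on $M$, $\mathcal{P}(N)$ the set of Borel probability measures on $N$, $C(M,\mathbb{R})$ the set of continuous real functions on $M$, and $D^1_+(M)$ the set of strictly positive $C^1$ functions $\rho$ on $M$ with $\int_M\rho\,dx=1$; $\rho\in D^1_+(M)$ is identified with the probability measure $\rho\,dx$, and $f_\#\rho$ denotes its pushforward under $f$ (and also the density of this pushforward). An embedding $Y:M\to\mathbb{R}^k$ is a $C^1$ map that is injective, has injective differential at every point, and is a homeomorphism onto its image. Let $m>2d+1$, let $\mathcal{D}$ be any metric on the set $\mathcal{P}(N)$ and $\mathbf{d}$ any metric on the set $C(M,\mathbb{R})$. Suppose that $\rho_1,\dots,\rho_m\in D^1_+(M)$ satisfy one of the following: (a) $(\rho_1,\dots,\rho_m)\in\boldsymbol{D}$, i.e. $\left(\frac{\rho_1}{\rho_m},\dots,\frac{\rho_{m-1}}{\rho_m}\right):M\to\mathbb{R}^{m-1}$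 is an embedding; or (b) $\rho_j=(h^{j-1})_\#\rho_1$ for $1\le j\le m$, where $\rho_1\in D_+^1(M)$ and $h\in\mathrm{Diff}^2(M,M)$ are such that, with $y:=\rho_1/h_\#\rho_1$, the time-delay map $x\mapsto\big(y(x),y(h(x)),\dots,y(h^{2d}(x))\big)$ is an embedding $M\to\mathbb{R}^{2d+1}$. (For every such pair $(\rho_1,h)$ these densities $\rho_1,\dots,\rho_m\in D^1_+(M)$ exist and are unique.) Then: (i) $\mathfrak{D}(f,g):=\sum_{j=1}^m\mathcal{D}(f_\#\rho_j,g_\#\rho_j)$ is a metric on $\mathrm{Diff}^1(M,N)$; (ii) for every $v\in\mathfrak{X}^1(M)$ and every $j$ the function $\mathrm{div}(\rho_jv)$ is continuous, and $\mathsf{D}(v,w):=\sum_{j=1}^m\mathbf{d}\big(\mathrm{div}(\rho_jv),\mathrm{div}(\rho_jw)\big)$ is a metric on $\mathfrak{X}^1(M)$. -/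

import Mathlib

open scoped Manifold ContDiff ENNReal
open MeasureTheory

noncomputable section

namespace PushforwardMetrics

/-- `D` is a metric on the set `X`. -/
structure IsMetric {X : Type*} (D : X → X → ℝ) : Prop where
  nonneg : ∀ x y, 0 ≤ D x y
  eq_zero_iff : ∀ x y, D x y = 0 ↔ x = y
  symm : ∀ x y, D x y = D y x
  triangle : ∀ x y z, D x z ≤ D x y + D y z

variable {d : ℕ} {M : Type*} [TopologicalSpace M] [ChartedSpace (EuclideanSpace ℝ (Fin d)) M]

/-- A smooth (that is, `C^∞`) Riemannian metric on the `d`-dimensional manifold `M`. -/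
abbrev SmoothMetric (d : ℕ) (M : Type*) [TopologicalSpace M]
    [ChartedSpace (EuclideanSpace ℝ (Fin d)) M] [IsManifold (𝓡 d) ∞ M] :=
  Bundle.ContMDiffRiemannianMetric (𝓡 d) ∞ (EuclideanSpace ℝ (Fin d))
    (fun x : M => TangentSpace (𝓡 d) x)

/-- The space of `C^1` vector fields on `M`. -/
abbrev C1VectorField (d : ℕ) (M : Type*) [TopologicalSpace M]
    [ChartedSpace (EuclideanSpace ℝ (Fin d)) M] [IsManifold (𝓡 d) ∞ M] :=
  ContMDiffSection (𝓡 d) (EuclideanSpace ℝ (Fin d)) 1 (fun x : M => TangentSpace (𝓡 d) x)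

/-- The `i`-th coordinate vector `∂/∂uᵢ` of the chart at `p`, at the point of `M` with
coordinates `u`. -/
def coordVec (p : M) (u : EuclideanSpace ℝ (Fin d)) (i : Fin d) :
    TangentSpace (𝓡 d) ((extChartAt (𝓡 d) p).symm u) :=
  mfderiv 𝓘(ℝ, EuclideanSpace ℝ (Fin d)) (𝓡 d) (extChartAt (𝓡 d) p).symm u
    (EuclideanSpace.single i (1 : ℝ))

section Riemannian

variable [IsManifold (𝓡 d) ∞ M]

/-- The function `√ det (g_{ij})` in the coordinates of the chart at `p`. -/
def sqrtDetGram (g : SmoothMetric d M) (p : M) (u : EuclideanSpace ℝ (Fin d)) : ℝ :=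
  Real.sqrt (Matrix.det (Matrix.of fun i j : Fin d =>
    g.inner ((extChartAt (𝓡 d) p).symm u) (coordVec p u i) (coordVec p u j)))

/-- The Riemannian divergence of the vector field `X` at `x`, computed in the chart at `x` by the
classical formula `div X = (1 / √det g) ∑ᵢ ∂ᵢ (√det g Xⁱ)`. -/
def divergence (g : SmoothMetric d M) (X : ∀ x : M, TangentSpace (𝓡 d) x) (x : M) : ℝ :=
  (sqrtDetGram g x (extChartAt (𝓡 d) x x))⁻¹ *
    ∑ i : Fin d, fderiv ℝ
      (fun u : EuclideanSpace ℝ (Fin d) =>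
        sqrtDetGram g x u *
          (show EuclideanSpace ℝ (Fin d) from
            mfderiv (𝓡 d) 𝓘(ℝ, EuclideanSpace ℝ (Fin d)) (extChartAt (𝓡 d) x)
              ((extChartAt (𝓡 d) x).symm u) (X ((extChartAt (𝓡 d) x).symm u))) i)
      (extChartAt (𝓡 d) x x) (EuclideanSpace.single i (1 : ℝ))

variable [MeasurableSpace M]

/-- The measure `√det g du` of the chart at `p`, carried by the domain of this chart. -/
def chartVolume (g : SmoothMetric d M) (p : M) : Measure M :=
  Measure.map (extChartAt (𝓡 d) p).symm
    ((volume.restrict (extChartAt (𝓡 d) p).target).withDensity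
      fun u => ENNReal.ofReal (sqrtDetGram g p u))

/-- The Riemannian volume measure. The measures `√det g du` of any two charts agree on the overlap
of the chart domains, so the measure on `M` that restricts to all of them on the chart domains is
their least upper bound in the lattice of measures. -/
def riemannianVolume (g : SmoothMetric d M) : Measure M := ⨆ p : M, chartVolume g p

/-- The strictly positive `C^1` functions on `M` with integral one with respect to the Riemannian
volume. -/
def PosDensity (g : SmoothMetric d M) : Type _ :=
  {ρ : ContMDiffMap (𝓡 d) 𝓘(ℝ, ℝ) M ℝ 1 //
    (∀ x, 0 < ρ x) ∧ ∫ x, ρ x ∂(riemannianVolume g) = 1}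

namespace PosDensity

variable {g : SmoothMetric d M}

instance : CoeFun (PosDensity g) (fun _ => M → ℝ) := ⟨fun ρ => ρ.1⟩

/-- The Borel probability measure `ρ dvol` with density `ρ`. -/
def toMeasure (ρ : PosDensity g) : ProbabilityMeasure M :=
  ⟨(riemannianVolume g).withDensity fun x => ENNReal.ofReal (ρ x), by
    have hint : Integrable (fun x => ρ x) (riemannianVolume g) := by
      by_contra h
      have h1 := ρ.2.2
      rw [integral_undef h] at h1
      exact zero_ne_one h1
    refine ⟨?_⟩
    rw [withDensity_apply _ MeasurableSet.univ, Measure.restrict_univ,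
      ← ofReal_integral_eq_lintegral_ofReal hint
        (Filter.Eventually.of_forall fun x => (ρ.2.1 x).le)]
    have h1 := ρ.2.2
    rw [h1, ENNReal.ofReal_one]⟩

/-- `σ` is the density of the pushforward `h_# ρ`: the measure `σ dvol` is the image of the
measure `ρ dvol` under `h`. -/
def IsPushforward (h : M → M) (ρ σ : PosDensity g) : Prop :=
  (σ.toMeasure : Measure M) = Measure.map h (ρ.toMeasure : Measure M)

end PosDensity

end Riemannian

/-- The map `Y : M → ℝ^k` is a `C^1` embedding. -/
structure IsC1Embedding {k : ℕ} (Y : M → Fin k → ℝ) : Prop where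
  contMDiff : ContMDiff (𝓡 d) 𝓘(ℝ, Fin k → ℝ) 1 Y
  injective : Function.Injective Y
  injective_mfderiv : ∀ x : M, Function.Injective (mfderiv (𝓡 d) 𝓘(ℝ, Fin k → ℝ) Y x)
  isEmbedding : Topology.IsEmbedding Y

/-- The time-delay map `x ↦ (y(x), y(h(x)), …, y(h^{k-1}(x)))`. -/
def delayMap {X : Type*} (k : ℕ) (y : X → ℝ) (h : X → X) (x : X) : Fin k → ℝ :=
  fun i => y (h^[i] x)

section Densities

variable [IsManifold (𝓡 d) ∞ M] [MeasurableSpace M]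

/-- The set of those families `(ρ₁, …, ρ_m)`, `m = n + 1`, of positive `C^1` probability densities
for which `(ρ₁/ρ_m, …, ρ_{m-1}/ρ_m) : M → ℝ^{m-1}` is an embedding. -/
def embeddingDensities (g : SmoothMetric d M) (n : ℕ) : Set (Fin (n + 1) → PosDensity g) :=
  {ρ | IsC1Embedding (d := d)
    fun (x : M) (i : Fin n) => ρ i.castSucc x / ρ (Fin.last n) x}

/-- The pair `(ρ₁, h)` is such that the observable `ρ₁ / h_# ρ₁` and the dynamics `h` have a
`(2d+1)`-dimensional time-delay map which is an embedding. -/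
def TakensPair (g : SmoothMetric d M) (ρ₁ : PosDensity g) (h : M ≃ₘ^2⟮𝓡 d, 𝓡 d⟯ M) : Prop :=
  ∃ σ : PosDensity g, PosDensity.IsPushforward h ρ₁ σ ∧
    IsC1Embedding (d := d) (delayMap (2 * d + 1) (fun x => ρ₁ x / σ x) h)

end Densities

/-- The pushforward of a Borel probability measure under a `C^1` diffeomorphism. -/
def pushProb {N : Type*} [TopologicalSpace N] [ChartedSpace (EuclideanSpace ℝ (Fin d)) N]
    [MeasurableSpace M] [BorelSpace M] [MeasurableSpace N] [BorelSpace N]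
    (f : M ≃ₘ^1⟮𝓡 d, 𝓡 d⟯ N) (μ : ProbabilityMeasure M) : ProbabilityMeasure N :=
  μ.map (f := f) f.continuous.measurable.aemeasurable

end PushforwardMetrics

end

noncomputable section

namespace PushforwardMetrics

/-! ### Jacobi's formula and the weighted divergence on Euclidean space -/

section Euclidean

variable {d : ℕ}

/-! Both claims reduce to one property of the densities, `HasSeparatingQuotients`: finitely many
quotients `ρ_a / ρ_b` form an injective immersion `R`. Symmetry, nonnegativity and the triangle
inequality pass to finite sums, so only separation of points has to be proved (`IsMetric.sum_comp`).

For diffeomorphisms, `f₁` and `f₂` with equal pushforwards give a self-map `φ = f₂⁻¹ ∘ f₁`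
preserving every `ρ_j`. Jacobians cancel in quotients (`IsPushforward.div_comp`), so `R ∘ φ = R` and
injectivity of `R` forces `φ = id`. For fields, put `u = v - w`. The product rule `div (ρ v) = ρ div
v + dρ(v)` (`divergence_smul`) turns equal divergences into `dρ_j(u) = -c ρ_j` with the same `c` for
all `j`. Hence every quotient has zero derivative along `u`, and injectivity of `dR` gives `u = 0`.

In case (a) the property is part of the hypothesis. In case (b), with `y = ρ₁ / h_#ρ₁`, consecutive
pushforwards have quotients `y ∘ h⁻ʲ`, so the delay map precomposed with `h⁻²ᵈ` consists of such
quotients.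

The divergence at each point is defined in that point's own chart, so its continuity rests on chart
independence (`weightedDiv_comp`). Of the volume measure only positivity on nonempty open sets is
needed: it makes a continuous density unique. -/

theorem contDiff_det {n : ℕ∞ω} :
    ContDiff ℝ n (fun A : EuclideanSpace ℝ (Fin d) →L[ℝ] EuclideanSpace ℝ (Fin d) => A.det) := by
  have h : (fun A : EuclideanSpace ℝ (Fin d) →L[ℝ] EuclideanSpace ℝ (Fin d) => A.det) =
      fun A => ∑ σ : Equiv.Perm (Fin d), ((Equiv.Perm.sign σ : ℤ) : ℝ) *
        ∏ i, (A (EuclideanSpace.single i 1)) (σ i) := by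
    funext A
    rw [ContinuousLinearMap.det,
      ← LinearMap.det_toMatrix (EuclideanSpace.basisFun (Fin d) ℝ).toBasis, Matrix.det_apply']
    simp [LinearMap.toMatrix_apply]
  rw [h]
  refine ContDiff.sum fun σ _ => contDiff_const.mul (contDiff_prod fun i _ => ?_)
  exact (PiLp.proj (𝕜 := ℝ) 2 (fun _ : Fin d => ℝ) (σ i)).contDiff.comp
    (ContinuousLinearMap.apply ℝ (EuclideanSpace ℝ (Fin d))
      (EuclideanSpace.single i (1 : ℝ))).contDiff

theorem fderiv_det_id (B : EuclideanSpace ℝ (Fin d) →L[ℝ] EuclideanSpace ℝ (Fin d)) :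
    fderiv ℝ (fun A : EuclideanSpace ℝ (Fin d) →L[ℝ] EuclideanSpace ℝ (Fin d) => A.det)
      (ContinuousLinearMap.id ℝ _) B = LinearMap.trace ℝ (EuclideanSpace ℝ (Fin d))
      (B : EuclideanSpace ℝ (Fin d) →ₗ[ℝ] EuclideanSpace ℝ (Fin d)) := by
  have h1 : HasDerivAt (fun t : ℝ => (ContinuousLinearMap.id ℝ (EuclideanSpace ℝ (Fin d))
      + t • B).det) (fderiv ℝ (fun A : EuclideanSpace ℝ (Fin d) →L[ℝ]
        EuclideanSpace ℝ (Fin d) => A.det) (ContinuousLinearMap.id ℝ _) B) 0 := by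
    have hl : HasDerivAt (fun t : ℝ => ContinuousLinearMap.id ℝ (EuclideanSpace ℝ (Fin d))
      + t • B) B 0 := by
      simpa using ((hasDerivAt_id (0 : ℝ)).smul_const B).const_add
        (ContinuousLinearMap.id ℝ (EuclideanSpace ℝ (Fin d)))
    have hd := ((contDiff_det (d := d) (n := 1)).differentiable one_ne_zero
      (ContinuousLinearMap.id ℝ _)).hasFDerivAt
    exact hd.comp_hasDerivAt_of_eq (0 : ℝ) hl (by ext; simp)
  set b := (EuclideanSpace.basisFun (Fin d) ℝ).toBasis
  set T := LinearMap.toMatrix b b (B : EuclideanSpace ℝ (Fin d) →ₗ[ℝ] EuclideanSpace ℝ (Fin d)) with hT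
  obtain ⟨p, hp⟩ : ∃ p : Polynomial ℝ, ∀ t : ℝ, (ContinuousLinearMap.id ℝ
      (EuclideanSpace ℝ (Fin d)) + t • B).det = 1 + T.trace * t + p.eval t * t ^ 2 := by
    -- The determinant of `1 + X T` is a polynomial in `X`; dividing by `X` twice leaves the
    -- remainder beyond the linear term.
    refine ⟨(Matrix.det (1 + (Polynomial.X : Polynomial ℝ) •
      T.map Polynomial.C)).divX.divX, fun t => ?_⟩
    rw [← Matrix.det_one_add_smul, ContinuousLinearMap.det, ← LinearMap.det_toMatrix b]
    congr 1
    simp [hT]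
  have h2 : HasDerivAt (fun t : ℝ => (ContinuousLinearMap.id ℝ (EuclideanSpace ℝ (Fin d))
      + t • B).det) T.trace 0 := by
    simp_rw [hp]
    have := (((hasDerivAt_id (0 : ℝ)).const_mul T.trace).const_add 1).add
      ((p.hasDerivAt 0).mul ((hasDerivAt_id (0 : ℝ)).pow 2))
    simpa [Pi.add_def, Pi.mul_def] using this
  rw [h1.unique h2, LinearMap.trace_eq_matrix_trace ℝ b]

/-- Jacobi's formula at an invertible value: factoring `A x = A u ∘ (B ∘ A x)` moves the
differentiation of `det` to the identity, where its derivative is the trace. -/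
theorem exists_hasFDerivAt_det {F : Type*} [NormedAddCommGroup F] [NormedSpace ℝ F]
    {A : F → EuclideanSpace ℝ (Fin d) →L[ℝ] EuclideanSpace ℝ (Fin d)}
    {A' : F →L[ℝ] EuclideanSpace ℝ (Fin d) →L[ℝ] EuclideanSpace ℝ (Fin d)} {u : F}
    (hA : HasFDerivAt A A' u)
    {B : EuclideanSpace ℝ (Fin d) →L[ℝ] EuclideanSpace ℝ (Fin d)}
    (hAB : A u ∘L B = ContinuousLinearMap.id ℝ _)
    (hBA : B ∘L A u = ContinuousLinearMap.id ℝ _) :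
    ∃ L : F →L[ℝ] ℝ, HasFDerivAt (fun x => (A x).det) L u ∧
      ∀ ξ, L ξ = (A u).det * LinearMap.trace ℝ (EuclideanSpace ℝ (Fin d))
      (B ∘L A' ξ : EuclideanSpace ℝ (Fin d) →ₗ[ℝ] EuclideanSpace ℝ (Fin d)) := by
  have h1 : (fun x => (A x).det) = fun x => (A u).det * (B ∘L A x).det := by
    funext x
    rw [← LinearMap.det_comp]
    change _ = LinearMap.det ((A u ∘L (B ∘L A x) : EuclideanSpace ℝ (Fin d) →L[ℝ] _) :
      EuclideanSpace ℝ (Fin d) →ₗ[ℝ] EuclideanSpace ℝ (Fin d))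
    rw [← ContinuousLinearMap.comp_assoc, hAB, ContinuousLinearMap.id_comp]
  have h2 : HasFDerivAt (fun x => B ∘L A x)
      ((ContinuousLinearMap.compL ℝ (EuclideanSpace ℝ (Fin d)) (EuclideanSpace ℝ (Fin d))
        (EuclideanSpace ℝ (Fin d)) B) ∘L A') u :=
    (ContinuousLinearMap.hasFDerivAt (ContinuousLinearMap.compL ℝ (EuclideanSpace ℝ (Fin d))
        (EuclideanSpace ℝ (Fin d)) (EuclideanSpace ℝ (Fin d)) B)).comp u hA
  have hd := ((contDiff_det (d := d) (n := 1)).differentiable one_ne_zero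
      (B ∘L A u)).hasFDerivAt
  have h3 := (hd.comp u h2).const_mul (A u).det
  rw [h1]
  refine ⟨_, h3, fun ξ => ?_⟩
  rw [hBA]
  simp only [smul_apply, ContinuousLinearMap.comp_apply, smul_eq_mul]
  rw [fderiv_det_id]
  rfl

/-- The divergence of a vector field of a Euclidean space with respect to the measure of
density `w`. -/
def weightedDiv (w : EuclideanSpace ℝ (Fin d) → ℝ)
    (X : EuclideanSpace ℝ (Fin d) → EuclideanSpace ℝ (Fin d))
    (u : EuclideanSpace ℝ (Fin d)) : ℝ :=
  (w u)⁻¹ * ∑ i : Fin d, fderiv ℝ (fun u => w u * X u i) u (EuclideanSpace.single i (1 : ℝ))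

theorem sum_coord_mul_apply_single {F : Type*} [NormedAddCommGroup F] [NormedSpace ℝ F]
    (L : EuclideanSpace ℝ (Fin d) →L[ℝ] F) (v : EuclideanSpace ℝ (Fin d)) :
    ∑ i, v i • L (EuclideanSpace.single i 1) = L v := by
  conv_rhs => rw [← (EuclideanSpace.basisFun (Fin d) ℝ).sum_repr v]
  simp

theorem sum_apply_single_coord (L : EuclideanSpace ℝ (Fin d) →L[ℝ] EuclideanSpace ℝ (Fin d)) :
    ∑ i, L (EuclideanSpace.single i 1) i = LinearMap.trace ℝ (EuclideanSpace ℝ (Fin d))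
      (L : EuclideanSpace ℝ (Fin d) →ₗ[ℝ] EuclideanSpace ℝ (Fin d)) := by
  rw [LinearMap.trace_eq_matrix_trace ℝ (EuclideanSpace.basisFun (Fin d) ℝ).toBasis,
    Matrix.trace]
  simp [LinearMap.toMatrix_apply]

/-- Splits the divergence into the logarithmic derivative of the weight along `X` and the trace of
`dX`, a form free of coordinates. -/
theorem weightedDiv_eq {w : EuclideanSpace ℝ (Fin d) → ℝ}
    {X : EuclideanSpace ℝ (Fin d) → EuclideanSpace ℝ (Fin d)} {u : EuclideanSpace ℝ (Fin d)}
    (hw : DifferentiableAt ℝ w u) (hX : DifferentiableAt ℝ X u) (h0 : w u ≠ 0) :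
    weightedDiv w X u = (w u)⁻¹ * fderiv ℝ w u (X u) +
      LinearMap.trace ℝ (EuclideanSpace ℝ (Fin d))
      (fderiv ℝ X u : EuclideanSpace ℝ (Fin d) →ₗ[ℝ] EuclideanSpace ℝ (Fin d)) := by
  have hXi (i : Fin d) : HasFDerivAt (fun u => X u i)
      ((PiLp.proj (𝕜 := ℝ) 2 (fun _ : Fin d => ℝ) i) ∘L fderiv ℝ X u) u :=
    (PiLp.proj (𝕜 := ℝ) 2 (fun _ : Fin d => ℝ) i).hasFDerivAt.comp u hX.hasFDerivAt
  have h1 (i : Fin d) : fderiv ℝ (fun u => w u * X u i) u (EuclideanSpace.single i (1 : ℝ)) =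
      w u * (fderiv ℝ X u (EuclideanSpace.single i 1)) i +
        X u i • fderiv ℝ w u (EuclideanSpace.single i 1) := by
    rw [(hw.hasFDerivAt.fun_mul (hXi i)).fderiv]
    simp
  rw [weightedDiv]
  simp_rw [h1]
  rw [Finset.sum_add_distrib, ← Finset.mul_sum, sum_coord_mul_apply_single,
    sum_apply_single_coord]
  field_simp
  ring

theorem weightedDiv_mul {w f : EuclideanSpace ℝ (Fin d) → ℝ}
    {X : EuclideanSpace ℝ (Fin d) → EuclideanSpace ℝ (Fin d)} {u : EuclideanSpace ℝ (Fin d)}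
    (hw : DifferentiableAt ℝ w u) (hf : DifferentiableAt ℝ f u) (hX : DifferentiableAt ℝ X u)
    (h0 : w u ≠ 0) :
    weightedDiv w (fun u => f u • X u) u = f u * weightedDiv w X u + fderiv ℝ f u (X u) := by
  rw [weightedDiv_eq hw (hf.fun_smul hX) h0, weightedDiv_eq hw hX h0, ← sum_apply_single_coord,
    ← sum_apply_single_coord]
  have h1 (i : Fin d) : (fderiv ℝ (fun u => f u • X u) u (EuclideanSpace.single i (1 : ℝ))) i =
      f u * (fderiv ℝ X u (EuclideanSpace.single i 1)) i +
        X u i • fderiv ℝ f u (EuclideanSpace.single i 1) := by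
    rw [(hf.hasFDerivAt.fun_smul hX.hasFDerivAt).fderiv]
    simp [mul_comm]
  simp_rw [h1]
  rw [Finset.sum_add_distrib, ← Finset.mul_sum, sum_coord_mul_apply_single]
  simp only [map_smul, smul_eq_mul]
  ring

theorem continuousAt_weightedDiv {w : EuclideanSpace ℝ (Fin d) → ℝ}
    {X : EuclideanSpace ℝ (Fin d) → EuclideanSpace ℝ (Fin d)} {u : EuclideanSpace ℝ (Fin d)}
    (hw : ContDiffAt ℝ 1 w u) (hX : ContDiffAt ℝ 1 X u) (h0 : w u ≠ 0) :
    ContinuousAt (weightedDiv w X) u := by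
  unfold weightedDiv
  refine (hw.continuousAt.inv₀ h0).mul (tendsto_finsetSum _ fun i _ => ?_)
  have h : ContDiffAt ℝ 1 (fun u => w u * X u i) u :=
    hw.mul ((PiLp.proj (𝕜 := ℝ) 2 (fun _ : Fin d => ℝ) i).contDiff.contDiffAt.comp
      u hX)
  exact ((h.fderiv_right (m := 0) (by simp)).continuousAt).clm_apply continuousAt_const

/-- Invariance of the weighted divergence under a `C^2` change of coordinates `τ`. -/
theorem weightedDiv_comp {w w' : EuclideanSpace ℝ (Fin d) → ℝ}
    {X X' τ : EuclideanSpace ℝ (Fin d) → EuclideanSpace ℝ (Fin d)}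
    {u : EuclideanSpace ℝ (Fin d)} (hτ : ContDiffAt ℝ 2 τ u)
    {B : EuclideanSpace ℝ (Fin d) →L[ℝ] EuclideanSpace ℝ (Fin d)}
    (hAB : fderiv ℝ τ u ∘L B = ContinuousLinearMap.id ℝ _)
    (hBA : B ∘L fderiv ℝ τ u = ContinuousLinearMap.id ℝ _)
    (hw' : DifferentiableAt ℝ w' (τ u)) (hX' : DifferentiableAt ℝ X' (τ u))
    (hX : DifferentiableAt ℝ X u) (h0 : w' (τ u) ≠ 0)
    (hww' : ∀ᶠ v in nhds u, w v = |(fderiv ℝ τ v).det| * w' (τ v))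
    (hXX' : ∀ᶠ v in nhds u, X' (τ v) = fderiv ℝ τ v (X v)) :
    weightedDiv w X u = weightedDiv w' X' (τ u) := by
  set A := fderiv ℝ τ with hA
  have hτ1 : HasFDerivAt τ (A u) u := (hτ.differentiableAt (by simp)).hasFDerivAt
  have hA1 : HasFDerivAt A (fderiv ℝ A u) u :=
    ((hτ.fderiv_right (m := 1) (by norm_num)).differentiableAt (by simp)).hasFDerivAt
  have hsymm (ξ η) : fderiv ℝ A u ξ η = fderiv ℝ A u η ξ :=
    (hτ.isSymmSndFDerivAt (by simp)) ξ η
  obtain ⟨L, hL, hLt⟩ := exists_hasFDerivAt_det hA1 hAB hBA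
  have hdet : (A u).det ≠ 0 := by
    intro h
    have h1 : LinearMap.det ((A u : EuclideanSpace ℝ (Fin d) →ₗ[ℝ] EuclideanSpace ℝ (Fin d)) ∘ₗ (B : EuclideanSpace ℝ (Fin d) →ₗ[ℝ] EuclideanSpace ℝ (Fin d))) = 1 := by
      change LinearMap.det ((A u ∘L B : EuclideanSpace ℝ (Fin d) →L[ℝ] _) : EuclideanSpace ℝ (Fin d) →ₗ[ℝ] EuclideanSpace ℝ (Fin d)) = 1
      rw [hAB]; exact LinearMap.det_id
    rw [LinearMap.det_comp] at h1
    rw [ContinuousLinearMap.det] at h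
    simp [h] at h1
  have habs : HasFDerivAt (fun v => |(A v).det|) ((SignType.sign (A u).det : ℝ) • L) u :=
    (hL.abs hdet)
  have hw1 : HasFDerivAt w (|(A u).det| • (fderiv ℝ w' (τ u) ∘L A u) +
      w' (τ u) • ((SignType.sign (A u).det : ℝ) • L)) u :=
    (habs.mul (hw'.hasFDerivAt.comp u hτ1)).congr_of_eventuallyEq hww'
  -- Differentiate `X' ∘ τ = A X`; the second term is `ξ ↦ (dA ξ) X`, which symmetry of the second
  -- derivative of `τ` later turns into `(dA X) ξ`.
  have hX1 : fderiv ℝ X' (τ u) ∘L A u =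
      A u ∘L fderiv ℝ X u + (fderiv ℝ A u).flip (X u) := by
    have h1 := (hX'.hasFDerivAt.comp u hτ1)
    have h2 := (hA1.clm_apply hX.hasFDerivAt).congr_of_eventuallyEq hXX'
    exact h1.unique h2
  have hwu := hww'.self_of_nhds
  have hXu := hXX'.self_of_nhds
  have hw0 : w u ≠ 0 := by
    rw [hwu]; exact mul_ne_zero (abs_ne_zero.2 hdet) h0
  rw [weightedDiv_eq hw1.differentiableAt hX hw0, weightedDiv_eq hw' hX' h0, hw1.fderiv, hwu, hXu]
  -- Conjugating by `A` preserves the trace, so `tr dX'` exceeds `tr dX` by `tr (B ∘ dA X)`. This is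
  -- also the logarithmic derivative of `|det A|` along `X`, which enters through `w`; the two sides
  -- therefore agree.
  have htr : LinearMap.trace ℝ (EuclideanSpace ℝ (Fin d))
      (fderiv ℝ X' (τ u) : EuclideanSpace ℝ (Fin d) →ₗ[ℝ] EuclideanSpace ℝ (Fin d)) =
      LinearMap.trace ℝ (EuclideanSpace ℝ (Fin d))
      (fderiv ℝ X u : EuclideanSpace ℝ (Fin d) →ₗ[ℝ] EuclideanSpace ℝ (Fin d)) +
      LinearMap.trace ℝ (EuclideanSpace ℝ (Fin d))
      (B ∘L fderiv ℝ A u (X u) : EuclideanSpace ℝ (Fin d) →ₗ[ℝ] EuclideanSpace ℝ (Fin d)) := by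
    have h1 : B ∘L (fderiv ℝ X' (τ u) ∘L A u) =
        fderiv ℝ X u + B ∘L fderiv ℝ A u (X u) := by
      rw [hX1]
      ext1 ξ
      have := DFunLike.congr_fun hBA (fderiv ℝ X u ξ)
      simp only [ContinuousLinearMap.comp_apply, ContinuousLinearMap.id_apply] at this
      simp [this, hsymm ξ]
    rw [← map_add]
    change _ = LinearMap.trace ℝ (EuclideanSpace ℝ (Fin d))
      ((fderiv ℝ X u + B ∘L fderiv ℝ A u (X u) : _ →L[ℝ] _)
      : EuclideanSpace ℝ (Fin d) →ₗ[ℝ] EuclideanSpace ℝ (Fin d))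
    rw [← h1]
    change _ = LinearMap.trace ℝ (EuclideanSpace ℝ (Fin d))
      ((B : EuclideanSpace ℝ (Fin d) →ₗ[ℝ] EuclideanSpace ℝ (Fin d)) ∘ₗ
      ((fderiv ℝ X' (τ u) ∘L A u : EuclideanSpace ℝ (Fin d) →L[ℝ] _) : EuclideanSpace ℝ (Fin d) →ₗ[ℝ] EuclideanSpace ℝ (Fin d)))
    rw [LinearMap.trace_comp_comm']
    change _ = LinearMap.trace ℝ (EuclideanSpace ℝ (Fin d))
      ((fderiv ℝ X' (τ u) ∘L (A u ∘L B) : EuclideanSpace ℝ (Fin d) →L[ℝ] _) : EuclideanSpace ℝ (Fin d) →ₗ[ℝ] EuclideanSpace ℝ (Fin d))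
    rw [hAB, ContinuousLinearMap.comp_id]
  rw [htr]
  simp only [add_apply, smul_apply,
    ContinuousLinearMap.comp_apply, smul_eq_mul, hLt]
  have hs : (SignType.sign (A u).det : ℝ) * (A u).det = |(A u).det| := by
    rw [mul_comm]; exact self_mul_sign _
  have habs0 : |(A u).det| ≠ 0 := abs_ne_zero.2 hdet
  rw [← mul_assoc (SignType.sign (A u).det : ℝ), hs]
  field_simp
  ring

end Euclidean

/-! ### Changes of coordinates and coordinate fields -/

section Charts

variable {d : ℕ} {M : Type*} [TopologicalSpace M] [ChartedSpace (EuclideanSpace ℝ (Fin d)) M]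

/-- The coordinate expression of a vector field in the chart at `p`. -/
def fieldInChart (X : ∀ x : M, TangentSpace (𝓡 d) x) (p : M) (u : EuclideanSpace ℝ (Fin d)) :
    EuclideanSpace ℝ (Fin d) :=
  mfderiv (𝓡 d) 𝓘(ℝ, EuclideanSpace ℝ (Fin d)) (extChartAt (𝓡 d) p)
    ((extChartAt (𝓡 d) p).symm u) (X ((extChartAt (𝓡 d) p).symm u))

/-- The change of coordinates from the chart at `p` to the chart at `q`. -/
def transition (p q : M) (u : EuclideanSpace ℝ (Fin d)) : EuclideanSpace ℝ (Fin d) :=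
  extChartAt (𝓡 d) q ((extChartAt (𝓡 d) p).symm u)

theorem transition_mem_target {p q : M} {u : EuclideanSpace ℝ (Fin d)}
    (hq : (extChartAt (𝓡 d) p).symm u ∈ (extChartAt (𝓡 d) q).source) :
    transition p q u ∈ (extChartAt (𝓡 d) q).target :=
  (extChartAt (𝓡 d) q).map_source hq

theorem symm_transition {p q : M} {u : EuclideanSpace ℝ (Fin d)}
    (hq : (extChartAt (𝓡 d) p).symm u ∈ (extChartAt (𝓡 d) q).source) :
    (extChartAt (𝓡 d) q).symm (transition p q u) = (extChartAt (𝓡 d) p).symm u :=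
  (extChartAt (𝓡 d) q).left_inv hq

theorem transition_transition {p q : M} {u : EuclideanSpace ℝ (Fin d)}
    (hu : u ∈ (extChartAt (𝓡 d) p).target)
    (hq : (extChartAt (𝓡 d) p).symm u ∈ (extChartAt (𝓡 d) q).source) :
    transition q p (transition p q u) = u := by
  rw [transition, symm_transition hq, (extChartAt (𝓡 d) p).right_inv hu]

variable [IsManifold (𝓡 d) ∞ M]

theorem divergence_eq_weightedDiv (g : SmoothMetric d M) (X : ∀ x : M, TangentSpace (𝓡 d) x)
    (x : M) : divergence g X x =
      weightedDiv (sqrtDetGram g x) (fieldInChart X x) (extChartAt (𝓡 d) x x) :=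
  rfl

theorem contMDiffAt_symm {p : M} {u : EuclideanSpace ℝ (Fin d)}
    (hu : u ∈ (extChartAt (𝓡 d) p).target) :
    ContMDiffAt 𝓘(ℝ, EuclideanSpace ℝ (Fin d)) (𝓡 d) ∞ (extChartAt (𝓡 d) p).symm u :=
  (contMDiffOn_extChartAt_symm p).contMDiffAt ((isOpen_extChartAt_target p).mem_nhds hu)

theorem contMDiffAt_chart {p x : M} (hx : x ∈ (extChartAt (𝓡 d) p).source) :
    ContMDiffAt (𝓡 d) 𝓘(ℝ, EuclideanSpace ℝ (Fin d)) ∞ (extChartAt (𝓡 d) p) x :=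
  contMDiffAt_extChartAt' (by rwa [extChartAt_source] at hx)

theorem eventually_symm_mem_source {p q : M} {u : EuclideanSpace ℝ (Fin d)}
    (hu : u ∈ (extChartAt (𝓡 d) p).target)
    (hq : (extChartAt (𝓡 d) p).symm u ∈ (extChartAt (𝓡 d) q).source) :
    ∀ᶠ v in nhds u, v ∈ (extChartAt (𝓡 d) p).target ∧
      (extChartAt (𝓡 d) p).symm v ∈ (extChartAt (𝓡 d) q).source :=
  Filter.inter_mem ((isOpen_extChartAt_target p).mem_nhds hu)
    ((contMDiffAt_symm hu).continuousAt ((isOpen_extChartAt_source q).mem_nhds hq))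

theorem contDiffAt_transition {p q : M} {u : EuclideanSpace ℝ (Fin d)}
    (hu : u ∈ (extChartAt (𝓡 d) p).target)
    (hq : (extChartAt (𝓡 d) p).symm u ∈ (extChartAt (𝓡 d) q).source) :
    ContDiffAt ℝ ∞ (transition p q) u :=
  ((contMDiffAt_chart hq).comp u (contMDiffAt_symm hu)).contDiffAt

theorem fderiv_transition_comp {p q : M} {u : EuclideanSpace ℝ (Fin d)}
    (hu : u ∈ (extChartAt (𝓡 d) p).target)
    (hq : (extChartAt (𝓡 d) p).symm u ∈ (extChartAt (𝓡 d) q).source) :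
    fderiv ℝ (transition q p) (transition p q u) ∘L fderiv ℝ (transition p q) u =
      ContinuousLinearMap.id ℝ _ := by
  have hp : (extChartAt (𝓡 d) q).symm (transition p q u) ∈ (extChartAt (𝓡 d) p).source := by
    rw [symm_transition hq]; exact (extChartAt (𝓡 d) p).map_target hu
  have h1 := ((contDiffAt_transition (transition_mem_target hq) hp).differentiableAt
    (by simp)).hasFDerivAt.comp u
      ((contDiffAt_transition hu hq).differentiableAt (by simp)).hasFDerivAt
  have h2 : transition q p ∘ transition p q =ᶠ[nhds u] id := by
    filter_upwards [eventually_symm_mem_source hu hq] with v hv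
    exact transition_transition hv.1 hv.2
  exact h1.unique ((hasFDerivAt_id u).congr_of_eventuallyEq h2)

theorem fieldInChart_transition (X : ∀ x : M, TangentSpace (𝓡 d) x) {p q : M}
    {u : EuclideanSpace ℝ (Fin d)} (hu : u ∈ (extChartAt (𝓡 d) p).target)
    (hq : (extChartAt (𝓡 d) p).symm u ∈ (extChartAt (𝓡 d) q).source) :
    fieldInChart X q (transition p q u) = fderiv ℝ (transition p q) u (fieldInChart X p u) := by
  have hx : (extChartAt (𝓡 d) p).symm u ∈ (extChartAt (𝓡 d) p).source :=
    (extChartAt (𝓡 d) p).map_target hu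
  have h0 : extChartAt (𝓡 d) p ((extChartAt (𝓡 d) p).symm u) = u :=
    (extChartAt (𝓡 d) p).right_inv hu
  have hτ := ((contDiffAt_transition hu hq).differentiableAt (by simp)).hasFDerivAt.hasMFDerivAt
  -- Writing the base point as a chart value lets the chain rule apply at the point of `M`.
  rw [← h0] at hτ
  have h1 := hτ.comp _ ((contMDiffAt_chart hx).mdifferentiableAt (by simp)).hasMFDerivAt
  have h2 : transition p q ∘ extChartAt (𝓡 d) p =ᶠ[nhds ((extChartAt (𝓡 d) p).symm u)]
      extChartAt (𝓡 d) q := by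
    filter_upwards [(isOpen_extChartAt_source p).mem_nhds hx] with y hy
    simp only [Function.comp, transition]
    rw [(extChartAt (𝓡 d) p).left_inv hy]
  have h3 := (h1.congr_of_eventuallyEq h2.symm).mfderiv
  rw [h0] at h3
  unfold fieldInChart
  rw [symm_transition hq, h3]
  rfl

theorem coordVec_transition {p q : M}
    {u : EuclideanSpace ℝ (Fin d)} (hu : u ∈ (extChartAt (𝓡 d) p).target)
    (hq : (extChartAt (𝓡 d) p).symm u ∈ (extChartAt (𝓡 d) q).source) (i : Fin d) :
    (coordVec p u i : EuclideanSpace ℝ (Fin d)) = ∑ k : Fin d,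
      (fderiv ℝ (transition p q) u (EuclideanSpace.single i 1)) k •
        (coordVec q (transition p q u) k : EuclideanSpace ℝ (Fin d)) := by
  have hτ := ((contDiffAt_transition hu hq).differentiableAt (by simp)).hasFDerivAt.hasMFDerivAt
  have h1 := ((contMDiffAt_symm (transition_mem_target hq)).mdifferentiableAt
    (by simp)).hasMFDerivAt.comp u hτ
  have h2 : (extChartAt (𝓡 d) q).symm ∘ transition p q =ᶠ[nhds u] (extChartAt (𝓡 d) p).symm := by
    filter_upwards [eventually_symm_mem_source hu hq] with v hv
    exact symm_transition hv.2
  have h3 := (h1.congr_of_eventuallyEq h2.symm).mfderiv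
  unfold coordVec
  rw [h3]
  exact (sum_coord_mul_apply_single (F := EuclideanSpace ℝ (Fin d)) (mfderiv 𝓘(ℝ, EuclideanSpace ℝ (Fin d)) (𝓡 d)
    (extChartAt (𝓡 d) q).symm (transition p q u)) _).symm

theorem injective_mfderiv_symm {p : M}
    {u : EuclideanSpace ℝ (Fin d)} (hu : u ∈ (extChartAt (𝓡 d) p).target) :
    Function.Injective (mfderiv 𝓘(ℝ, EuclideanSpace ℝ (Fin d)) (𝓡 d)
      (extChartAt (𝓡 d) p).symm u) := by
  have hx : (extChartAt (𝓡 d) p).symm u ∈ (extChartAt (𝓡 d) p).source :=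
    (extChartAt (𝓡 d) p).map_target hu
  have h1 := ((contMDiffAt_chart hx).mdifferentiableAt (by simp)).hasMFDerivAt.comp u
    ((contMDiffAt_symm hu).mdifferentiableAt (by simp)).hasMFDerivAt
  have h2 : extChartAt (𝓡 d) p ∘ (extChartAt (𝓡 d) p).symm =ᶠ[nhds u] id := by
    filter_upwards [(isOpen_extChartAt_target p).mem_nhds hu] with v hv
    exact (extChartAt (𝓡 d) p).right_inv hv
  have h3 := (h1.congr_of_eventuallyEq h2.symm)
  have h4 := hasMFDerivAt_unique h3 (hasMFDerivAt_id u)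
  intro a b hab
  set L := mfderiv 𝓘(ℝ, EuclideanSpace ℝ (Fin d)) (𝓡 d) (extChartAt (𝓡 d) p).symm u
  have h5 (c) : mfderiv (𝓡 d) 𝓘(ℝ, EuclideanSpace ℝ (Fin d)) (extChartAt (𝓡 d) p)
      ((extChartAt (𝓡 d) p).symm u) (L c) = c := DFunLike.congr_fun h4 c
  have h6 := h5 a
  rw [hab] at h6
  exact h6.symm.trans (h5 b)

end Charts

/-! ### Gram determinants, chart independence of the divergence, product rule -/

section Riemannian

variable {d : ℕ} {M : Type*} [TopologicalSpace M] [ChartedSpace (EuclideanSpace ℝ (Fin d)) M]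
  [IsManifold (𝓡 d) ∞ M]

theorem bilinear_sum_smul {F : Type*} [NormedAddCommGroup F] [NormedSpace ℝ F]
    (B : F →L[ℝ] F →L[ℝ] ℝ) (a b : Fin d → ℝ) (V : Fin d → F) :
    B (∑ k, a k • V k) (∑ l, b l • V l) = ∑ k, ∑ l, a k * B (V k) (V l) * b l := by
  simp only [map_sum, map_smul, sum_apply, smul_apply, smul_eq_mul, Finset.mul_sum]
  rw [Finset.sum_comm]
  refine Finset.sum_congr rfl fun k _ => Finset.sum_congr rfl fun l _ => ?_
  ring

/-- The Gram matrix `(g_{ij})` in the chart at `p`. -/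
def gramMatrix (g : SmoothMetric d M) (p : M) (u : EuclideanSpace ℝ (Fin d)) :
    Matrix (Fin d) (Fin d) ℝ :=
  Matrix.of fun i j => g.inner ((extChartAt (𝓡 d) p).symm u) (coordVec p u i) (coordVec p u j)

theorem sqrtDetGram_eq (g : SmoothMetric d M) (p : M) (u : EuclideanSpace ℝ (Fin d)) :
    sqrtDetGram g p u = √(gramMatrix g p u).det :=
  rfl

theorem posDef_gramMatrix (g : SmoothMetric d M) {p : M} {u : EuclideanSpace ℝ (Fin d)}
    (hu : u ∈ (extChartAt (𝓡 d) p).target) : (gramMatrix g p u).PosDef := by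
  set L : EuclideanSpace ℝ (Fin d) →L[ℝ] EuclideanSpace ℝ (Fin d) :=
    mfderiv 𝓘(ℝ, EuclideanSpace ℝ (Fin d)) (𝓡 d) (extChartAt (𝓡 d) p).symm u with hL
  set B : EuclideanSpace ℝ (Fin d) →L[ℝ] EuclideanSpace ℝ (Fin d) →L[ℝ] ℝ :=
    g.inner ((extChartAt (𝓡 d) p).symm u) with hB
  have hG : gramMatrix g p u = Matrix.of fun i j =>
      B (L (EuclideanSpace.single i 1)) (L (EuclideanSpace.single j 1)) := rfl
  have hpos : ∀ v, v ≠ 0 → 0 < B v v := g.pos ((extChartAt (𝓡 d) p).symm u)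
  have hsymm : ∀ v w, B v w = B w v := g.symm ((extChartAt (𝓡 d) p).symm u)
  have hinj : Function.Injective L := injective_mfderiv_symm hu
  rw [hG]
  refine Matrix.PosDef.of_dotProduct_mulVec_pos ?_ fun x hx => ?_
  · ext i j
    simp [hsymm (L (EuclideanSpace.single i 1))]
  · set v : EuclideanSpace ℝ (Fin d) := WithLp.toLp 2 x with hv
    have h1 : L v = ∑ i, x i • L (EuclideanSpace.single i 1) :=
      (sum_coord_mul_apply_single L v).symm
    have h2 : L v ≠ 0 := by
      intro h
      have : v = 0 := hinj (h.trans (map_zero L).symm)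
      exact hx (by simpa [hv] using this)
    have h3 := hpos _ h2
    rw [h1, bilinear_sum_smul] at h3
    simpa [dotProduct, Matrix.mulVec, Finset.mul_sum, mul_assoc] using h3

theorem sqrtDetGram_pos (g : SmoothMetric d M) {p : M} {u : EuclideanSpace ℝ (Fin d)}
    (hu : u ∈ (extChartAt (𝓡 d) p).target) : 0 < sqrtDetGram g p u :=
  Real.sqrt_pos.2 (posDef_gramMatrix g hu).det_pos

/-- The Gram matrices are congruent, `G_p = Jᵀ G_q J` with `J` the Jacobian matrix; take
determinants and square roots. This is the weight hypothesis of `weightedDiv_comp`. -/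
theorem sqrtDetGram_transition (g : SmoothMetric d M) {p q : M} {u : EuclideanSpace ℝ (Fin d)}
    (hu : u ∈ (extChartAt (𝓡 d) p).target)
    (hq : (extChartAt (𝓡 d) p).symm u ∈ (extChartAt (𝓡 d) q).source) :
    sqrtDetGram g p u =
      |(fderiv ℝ (transition p q) u).det| * sqrtDetGram g q (transition p q u) := by
  set A := fderiv ℝ (transition p q) u with hA
  set J : Matrix (Fin d) (Fin d) ℝ :=
    Matrix.of fun k i => (A (EuclideanSpace.single i 1)) k with hJ
  have hdet : A.det = J.det := by
    rw [ContinuousLinearMap.det,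
      ← LinearMap.det_toMatrix (EuclideanSpace.basisFun (Fin d) ℝ).toBasis]
    congr 1
  have hG : gramMatrix g p u = J.transpose * gramMatrix g q (transition p q u) * J := by
    ext i j
    set B : EuclideanSpace ℝ (Fin d) →L[ℝ] EuclideanSpace ℝ (Fin d) →L[ℝ] ℝ :=
      g.inner ((extChartAt (𝓡 d) p).symm u) with hB
    set V : Fin d → EuclideanSpace ℝ (Fin d) := fun k => coordVec q (transition p q u) k with hV
    have h1 : gramMatrix g q (transition p q u) = Matrix.of fun k l => B (V k) (V l) := by
      unfold gramMatrix
      rw [symm_transition hq]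
      rfl
    have h2 : gramMatrix g p u i j = B (∑ k, J k i • V k) (∑ l, J l j • V l) := by
      have h3 (i : Fin d) : (coordVec p u i : EuclideanSpace ℝ (Fin d)) = ∑ k, J k i • V k :=
        coordVec_transition hu hq i
      rw [← h3, ← h3]
      rfl
    rw [h2, h1, bilinear_sum_smul]
    simp only [Matrix.mul_apply, Matrix.transpose_apply, Matrix.of_apply, Finset.sum_mul]
    exact Finset.sum_comm
  rw [sqrtDetGram_eq, sqrtDetGram_eq, hG, Matrix.det_mul, Matrix.det_mul, Matrix.det_transpose,
    hdet, mul_right_comm, ← sq, Real.sqrt_mul (sq_nonneg _), Real.sqrt_sq_eq_abs]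

theorem contMDiffAt_coordVec {p : M} {u : EuclideanSpace ℝ (Fin d)}
    (hu : u ∈ (extChartAt (𝓡 d) p).target) (i : Fin d) :
    ContMDiffAt 𝓘(ℝ, EuclideanSpace ℝ (Fin d)) ((𝓡 d).prod 𝓘(ℝ, EuclideanSpace ℝ (Fin d))) ∞
      (fun u => (⟨(extChartAt (𝓡 d) p).symm u, coordVec p u i⟩ : TangentBundle (𝓡 d) M)) u := by
  have h1 := (contMDiffOn_extChartAt_symm (I := 𝓡 d) (n := ∞) p).contMDiffOn_tangentMapWithin
    (m := ∞) (by simp) (isOpen_extChartAt_target p).uniqueMDiffOn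
  have h2 : ContMDiff 𝓘(ℝ, EuclideanSpace ℝ (Fin d))
      (𝓘(ℝ, EuclideanSpace ℝ (Fin d)).prod 𝓘(ℝ, EuclideanSpace ℝ (Fin d))) ∞
      (fun u : EuclideanSpace ℝ (Fin d) => (⟨u, (EuclideanSpace.single i (1 : ℝ) :
        EuclideanSpace ℝ (Fin d))⟩ :
        TangentBundle 𝓘(ℝ, EuclideanSpace ℝ (Fin d)) (EuclideanSpace ℝ (Fin d)))) :=
    contMDiff_vectorSpace_iff_contDiff.2 contDiff_const
  have h3 := (h1.comp h2.contMDiffOn (s := (extChartAt (𝓡 d) p).target) (fun u hu => hu))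
  refine (h3.contMDiffAt ((isOpen_extChartAt_target p).mem_nhds hu)).congr_of_eventuallyEq ?_
  filter_upwards [(isOpen_extChartAt_target p).mem_nhds hu] with v hv
  simp only [Function.comp, tangentMapWithin, coordVec]
  rw [mfderivWithin_of_isOpen (isOpen_extChartAt_target p) hv]

theorem contDiffAt_sqrtDetGram (g : SmoothMetric d M) {p : M} {u : EuclideanSpace ℝ (Fin d)}
    (hu : u ∈ (extChartAt (𝓡 d) p).target) : ContDiffAt ℝ ∞ (sqrtDetGram g p) u := by
  have hG (i j) : ContDiffAt ℝ ∞ (fun u => gramMatrix g p u i j) u := by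
    have h1 := (g.contMDiff.contMDiffAt (x := (extChartAt (𝓡 d) p).symm u)).comp u
      (contMDiffAt_symm hu)
    have h2 : ContMDiffAt 𝓘(ℝ, EuclideanSpace ℝ (Fin d)) ((𝓡 d).prod 𝓘(ℝ)) ∞
        (fun m ↦ Bundle.TotalSpace.mk' ℝ (E := Bundle.Trivial M ℝ)
          ((extChartAt (𝓡 d) p).symm m) (g.inner ((extChartAt (𝓡 d) p).symm m)
            (coordVec p m i) (coordVec p m j))) u := by
      apply ContMDiffAt.clm_bundle_apply₂ (F₁ := EuclideanSpace ℝ (Fin d))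
        (F₂ := EuclideanSpace ℝ (Fin d))
      · exact h1
      · exact contMDiffAt_coordVec hu i
      · exact contMDiffAt_coordVec hu j
    rw [Bundle.contMDiffAt_totalSpace] at h2
    exact h2.2.contDiffAt
  have hd : ContDiffAt ℝ ∞ (fun u => (gramMatrix g p u).det) u := by
    simp_rw [Matrix.det_apply']
    exact ContDiffAt.sum fun σ _ => contDiffAt_const.mul (contDiffAt_prod fun i _ => hG _ _)
  exact hd.sqrt (posDef_gramMatrix g hu).det_pos.ne'

theorem contDiffAt_fieldInChart {X : ∀ x : M, TangentSpace (𝓡 d) x}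
    (hX : ContMDiff (𝓡 d) ((𝓡 d).prod 𝓘(ℝ, EuclideanSpace ℝ (Fin d))) 1
      (fun x => (⟨x, X x⟩ : TangentBundle (𝓡 d) M)))
    {p : M} {u : EuclideanSpace ℝ (Fin d)} (hu : u ∈ (extChartAt (𝓡 d) p).target) :
    ContDiffAt ℝ 1 (fieldInChart X p) u := by
  have h0 : ContMDiffOn (𝓡 d) 𝓘(ℝ, EuclideanSpace ℝ (Fin d)) ∞ (extChartAt (𝓡 d) p)
      (extChartAt (𝓡 d) p).source := by
    rw [extChartAt_source]; exact contMDiffOn_extChartAt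
  have h1 := h0.contMDiffOn_tangentMapWithin
    (m := 1) (by decide) (isOpen_extChartAt_source p).uniqueMDiffOn
  have h2 := (h1.comp hX.contMDiffOn (s := (extChartAt (𝓡 d) p).source) (fun u hu => hu))
  have hx : (extChartAt (𝓡 d) p).symm u ∈ (extChartAt (𝓡 d) p).source :=
    (extChartAt (𝓡 d) p).map_target hu
  have h3 := (h2.contMDiffAt ((isOpen_extChartAt_source p).mem_nhds hx)).comp u
    ((contMDiffAt_symm hu).of_le (by simp))
  have h4 := ((contMDiff_snd_tangentBundle_modelSpace (EuclideanSpace ℝ (Fin d))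
    𝓘(ℝ, EuclideanSpace ℝ (Fin d)) (n := 1)).contMDiffAt.comp u h3).contDiffAt
  refine h4.congr_of_eventuallyEq ?_
  filter_upwards [(isOpen_extChartAt_target p).mem_nhds hu] with v hv
  simp only [Function.comp, tangentMapWithin, fieldInChart]
  rw [mfderivWithin_of_isOpen (isOpen_extChartAt_source p) ((extChartAt (𝓡 d) p).map_target hv)]

/-- The divergence may be computed in any chart. -/
theorem divergence_eq_weightedDiv_of_mem_source (g : SmoothMetric d M)
    {X : ∀ x : M, TangentSpace (𝓡 d) x}
    (hX : ContMDiff (𝓡 d) ((𝓡 d).prod 𝓘(ℝ, EuclideanSpace ℝ (Fin d))) 1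
      (fun x => (⟨x, X x⟩ : TangentBundle (𝓡 d) M)))
    {q x : M} (hx : x ∈ (extChartAt (𝓡 d) q).source) :
    divergence g X x =
      weightedDiv (sqrtDetGram g q) (fieldInChart X q) (extChartAt (𝓡 d) q x) := by
  set u := extChartAt (𝓡 d) x x with hu
  have hxu : (extChartAt (𝓡 d) x).symm u = x := extChartAt_to_inv x
  have hut : u ∈ (extChartAt (𝓡 d) x).target := mem_extChartAt_target x
  have hq : (extChartAt (𝓡 d) x).symm u ∈ (extChartAt (𝓡 d) q).source := by rwa [hxu]
  have hτt := transition_mem_target hq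
  have hxs : (extChartAt (𝓡 d) q).symm (transition x q u) ∈ (extChartAt (𝓡 d) x).source := by
    rw [symm_transition hq, hxu]; exact mem_extChartAt_source x
  have hτ : extChartAt (𝓡 d) q x = transition x q u := by rw [transition, hxu]
  -- Exchanging the two charts yields the other one-sided inverse of the Jacobian.
  have hAB := fderiv_transition_comp hτt hxs
  rw [transition_transition hut hq] at hAB
  rw [divergence_eq_weightedDiv, hτ]
  refine weightedDiv_comp ((contDiffAt_transition hut hq).of_le (by decide)) hAB
    (fderiv_transition_comp hut hq)
    ((contDiffAt_sqrtDetGram g hτt).differentiableAt (by simp))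
    ((contDiffAt_fieldInChart hX hτt).differentiableAt (by simp))
    ((contDiffAt_fieldInChart hX hut).differentiableAt (by simp))
    (sqrtDetGram_pos g hτt).ne' ?_ ?_
  · filter_upwards [eventually_symm_mem_source hut hq] with v hv
    exact sqrtDetGram_transition g hv.1 hv.2
  · filter_upwards [eventually_symm_mem_source hut hq] with v hv
    exact fieldInChart_transition X hv.1 hv.2

/-- Near `q` the divergence can be read in the single chart at `q`, where it is a continuous
expression in first derivatives. -/
theorem continuous_divergence (g : SmoothMetric d M) {X : ∀ x : M, TangentSpace (𝓡 d) x}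
    (hX : ContMDiff (𝓡 d) ((𝓡 d).prod 𝓘(ℝ, EuclideanSpace ℝ (Fin d))) 1
      (fun x => (⟨x, X x⟩ : TangentBundle (𝓡 d) M))) :
    Continuous (divergence g X) := by
  refine continuous_iff_continuousAt.2 fun q => ?_
  have hq := mem_extChartAt_target (I := 𝓡 d) q
  have h1 : ContinuousAt (fun x => weightedDiv (sqrtDetGram g q) (fieldInChart X q)
      (extChartAt (𝓡 d) q x)) q :=
    ContinuousAt.comp (f := extChartAt (𝓡 d) q)
      (continuousAt_weightedDiv ((contDiffAt_sqrtDetGram g hq).of_le (by simp))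
        (contDiffAt_fieldInChart hX hq) (sqrtDetGram_pos g hq).ne') (continuousAt_extChartAt q)
  refine h1.congr ?_
  filter_upwards [extChartAt_source_mem_nhds (I := 𝓡 d) q] with x hx
  exact (divergence_eq_weightedDiv_of_mem_source g hX hx).symm

/-- The derivative of the function `f` at `x` in the direction `v`. -/
def dirDeriv (f : M → ℝ) (x : M) (v : TangentSpace (𝓡 d) x) : ℝ :=
  mfderiv (𝓡 d) 𝓘(ℝ, ℝ) f x v

theorem divergence_smul (g : SmoothMetric d M) {X : ∀ x : M, TangentSpace (𝓡 d) x}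
    (hX : ContMDiff (𝓡 d) ((𝓡 d).prod 𝓘(ℝ, EuclideanSpace ℝ (Fin d))) 1
      (fun x => (⟨x, X x⟩ : TangentBundle (𝓡 d) M)))
    {f : M → ℝ} (hf : ContMDiff (𝓡 d) 𝓘(ℝ, ℝ) 1 f) (x : M) :
    divergence g (fun x => f x • X x) x =
      f x * divergence g X x + dirDeriv f x (X x) := by
  have hx := mem_extChartAt_target (I := 𝓡 d) x
  have hxx : (extChartAt (𝓡 d) x).symm (extChartAt (𝓡 d) x x) = x := extChartAt_to_inv x
  have h1 : fieldInChart (fun x => f x • X x) x = fun u =>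
      (f ∘ (extChartAt (𝓡 d) x).symm) u • fieldInChart X x u := by
    funext u
    exact map_smul _ _ _
  have hfd : ContMDiffAt 𝓘(ℝ, EuclideanSpace ℝ (Fin d)) 𝓘(ℝ, ℝ) 1
      (f ∘ (extChartAt (𝓡 d) x).symm) (extChartAt (𝓡 d) x x) :=
    hf.contMDiffAt.comp _ ((contMDiffAt_symm hx).of_le (by simp))
  rw [divergence_eq_weightedDiv, h1, weightedDiv_mul
    ((contDiffAt_sqrtDetGram g hx).differentiableAt (by simp))
    (hfd.contDiffAt.differentiableAt (by simp))
    ((contDiffAt_fieldInChart hX hx).differentiableAt (by simp)) (sqrtDetGram_pos g hx).ne',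
    divergence_eq_weightedDiv]
  congr 1
  · simp only [Function.comp, hxx]
  · have h2 : (f ∘ (extChartAt (𝓡 d) x).symm) ∘ extChartAt (𝓡 d) x =ᶠ[nhds x] f := by
      filter_upwards [extChartAt_source_mem_nhds (I := 𝓡 d) x] with y hy
      simp only [Function.comp]
      rw [(extChartAt (𝓡 d) x).left_inv hy]
    have h3 := ((hfd.contDiffAt.differentiableAt (by simp)).hasFDerivAt.hasMFDerivAt.comp x
      ((contMDiffAt_chart (mem_extChartAt_source x)).mdifferentiableAt
        (by simp)).hasMFDerivAt).congr_of_eventuallyEq h2.symm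
    rw [dirDeriv, h3.mfderiv]
    unfold fieldInChart
    rw [hxx]
    rfl

end Riemannian

/-! ### Pulling a metric back along a separating family; densities and image measures -/

theorem IsMetric.sum_comp {ι X Y : Type*} [Fintype ι] {D : X → X → ℝ} (hD : IsMetric D)
    {F : ι → Y → X} (hF : ∀ y z, (∀ i, F i y = F i z) → y = z) :
    IsMetric fun y z => ∑ i, D (F i y) (F i z) where
  nonneg y z := Finset.sum_nonneg fun i _ => hD.nonneg _ _
  eq_zero_iff y z := by
    rw [Finset.sum_eq_zero_iff_of_nonneg fun i _ => hD.nonneg _ _]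
    constructor
    · exact fun h => hF y z fun i => (hD.eq_zero_iff _ _).1 (h i (Finset.mem_univ i))
    · rintro rfl i -
      exact (hD.eq_zero_iff _ _).2 rfl
  symm y z := Finset.sum_congr rfl fun i _ => hD.symm _ _
  triangle x y z := by
    rw [← Finset.sum_add_distrib]
    exact Finset.sum_le_sum fun i _ => hD.triangle _ _ _

theorem map_withDensity_comp {X Y : Type*} [MeasurableSpace X] [MeasurableSpace Y]
    (μ : Measure X) {φ : X → Y} (hφ : Measurable φ) {r : Y → ℝ≥0∞} (hr : Measurable r) :
    (Measure.map φ μ).withDensity r = Measure.map φ (μ.withDensity (r ∘ φ)) := by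
  ext s hs
  rw [withDensity_apply _ hs, Measure.map_apply hφ hs, withDensity_apply _ (hφ hs),
    Measure.restrict_map hφ hs, lintegral_map hr hφ]
  rfl

/-! ### Positivity of the volume, uniqueness and pushforward of densities -/

section Volume

variable {d : ℕ} {M : Type*} [TopologicalSpace M] [ChartedSpace (EuclideanSpace ℝ (Fin d)) M]
  [IsManifold (𝓡 d) ∞ M] [MeasurableSpace M]

theorem PosDensity.continuous {g : SmoothMetric d M} (ρ : PosDensity g) : Continuous ρ :=
  ρ.1.contMDiff.continuous

theorem PosDensity.coe_toMeasure {g : SmoothMetric d M} (ρ : PosDensity g) : (ρ.toMeasure : Measure M) =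
    (riemannianVolume g).withDensity fun x => ENNReal.ofReal (ρ x) :=
  rfl

variable [BorelSpace M]

/-- The volume dominates each chart measure, and around a point of `U` the chart measure has a
positive density on a nonempty open set of coordinates. -/
instance isOpenPosMeasure_riemannianVolume (g : SmoothMetric d M) :
    (riemannianVolume g).IsOpenPosMeasure := by
  refine ⟨fun U hU ⟨p, hp⟩ h0 => ?_⟩
  have h1 : chartVolume g p U = 0 :=
    le_antisymm ((le_iSup (chartVolume g) p U).trans h0.le) zero_le
  set t := (extChartAt (𝓡 d) p).target with ht
  have hto : IsOpen t := isOpen_extChartAt_target p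
  have hc : ContinuousOn (extChartAt (𝓡 d) p).symm t := continuousOn_extChartAt_symm p
  have hm : AEMeasurable (extChartAt (𝓡 d) p).symm
      ((volume.restrict t).withDensity fun u => ENNReal.ofReal (sqrtDetGram g p u)) :=
    (hc.aemeasurable hto.measurableSet).mono_ac (withDensity_absolutelyContinuous _ _)
  have hV : IsOpen (t ∩ (extChartAt (𝓡 d) p).symm ⁻¹' U) := hc.isOpen_inter_preimage hto hU
  have hmem : extChartAt (𝓡 d) p p ∈ t ∩ (extChartAt (𝓡 d) p).symm ⁻¹' U :=
    ⟨mem_extChartAt_target p, by rwa [Set.mem_preimage, extChartAt_to_inv]⟩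
  have hdm : AEMeasurable (fun u => ENNReal.ofReal (sqrtDetGram g p u)) (volume.restrict t) := by
    refine (ContinuousOn.aemeasurable ?_ hto.measurableSet).ennreal_ofReal
    exact fun u hu => (contDiffAt_sqrtDetGram g hu).continuousAt.continuousWithinAt
  rw [chartVolume, Measure.map_apply_of_aemeasurable hm hU.measurableSet] at h1
  have h2 := measure_mono_null (Set.inter_subset_right (s := t)) h1
  rw [withDensity_apply _ hV.measurableSet, lintegral_eq_zero_iff' hdm.restrict,
    Measure.restrict_restrict hV.measurableSet, Set.inter_eq_left.2 Set.inter_subset_left,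
    Filter.EventuallyEq, ae_restrict_iff' hV.measurableSet] at h2
  have h3 : volume (t ∩ (extChartAt (𝓡 d) p).symm ⁻¹' U) = 0 := by
    refine measure_mono_null (fun u hu => ?_) (ae_iff.1 h2)
    have h4 : u ∈ t ∧ (extChartAt (𝓡 d) p).symm u ∈ U := hu
    simpa [h4] using ⟨h4.2, sqrtDetGram_pos g h4.1⟩
  exact hV.measure_ne_zero volume ⟨_, hmem⟩ h3

namespace PosDensity

variable {g : SmoothMetric d M}

theorem toMeasure_withDensity (ρ : PosDensity g) {r : M → ℝ} (hr : Continuous r) :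
    (ρ.toMeasure : Measure M).withDensity (fun x => ENNReal.ofReal (r x)) =
      (riemannianVolume g).withDensity fun x => ENNReal.ofReal (ρ x * r x) := by
  rw [coe_toMeasure, ← withDensity_mul _ ρ.continuous.measurable.ennreal_ofReal
    hr.measurable.ennreal_ofReal]
  congr 1
  funext x
  exact (ENNReal.ofReal_mul (ρ.2.1 x).le).symm

theorem toMeasure_eq_withDensity_div (ρ σ : PosDensity g) : (ρ.toMeasure : Measure M) =
    (σ.toMeasure : Measure M).withDensity fun x => ENNReal.ofReal (ρ x / σ x) := by
  have hr : Continuous fun x => ρ x / σ x :=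
    ρ.continuous.div σ.continuous fun x => (σ.2.1 x).ne'
  rw [toMeasure_withDensity σ hr, coe_toMeasure]
  congr 1
  funext x
  rw [mul_div_cancel₀ _ (σ.2.1 x).ne']

/-- Every positive continuous function whose density measure is that of `ρ` equals `ρ`. -/
theorem eq_of_withDensity_eq (ρ : PosDensity g) {f : M → ℝ} (hf : Continuous f)
    (hf0 : ∀ x, 0 ≤ f x)
    (h : (ρ.toMeasure : Measure M) =
      (riemannianVolume g).withDensity fun x => ENNReal.ofReal (f x)) (x : M) : ρ x = f x := by
  rw [coe_toMeasure, withDensity_eq_iff ρ.continuous.measurable.ennreal_ofReal.aemeasurable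
    hf.measurable.ennreal_ofReal.aemeasurable] at h
  · have h1 : (fun x => ρ x) =ᵐ[riemannianVolume g] f := by
      filter_upwards [h] with y hy
      exact (ENNReal.ofReal_eq_ofReal_iff (ρ.2.1 y).le (hf0 y)).1 hy
    exact congrFun ((ρ.continuous.ae_eq_iff_eq _ hf).1 h1) x
  -- Cancelling densities requires one finite integral; here it is the total mass one.
  · have h1 : (ρ.toMeasure : Measure M) Set.univ = 1 := measure_univ
    rw [coe_toMeasure, withDensity_apply _ MeasurableSet.univ, Measure.restrict_univ] at h1
    rw [h1]
    exact ENNReal.one_ne_top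

theorem ext_of_toMeasure_eq {ρ σ : PosDensity g}
    (h : (ρ.toMeasure : Measure M) = (σ.toMeasure : Measure M)) : ρ = σ :=
  Subtype.ext (ContMDiffMap.ext (eq_of_withDensity_eq ρ σ.continuous (fun x => (σ.2.1 x).le) h))

/-- Quotients of densities are transported by a homeomorphism. -/
theorem IsPushforward.div_comp {φ ψ : M → M} (hφ : Continuous φ) (hψ : Continuous ψ)
    (hψφ : Function.LeftInverse ψ φ) {α β α' β' : PosDensity g}
    (hα : IsPushforward φ α α') (hβ : IsPushforward φ β β') (x : M) :
    α' (φ x) / β' (φ x) = α x / β x := by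
  have hr : Continuous fun x => α' x / β' x :=
    α'.continuous.div β'.continuous fun x => (β'.2.1 x).ne'
  -- With `r = α' / β'`, the measure `α' = r β'` is the image of `(r ∘ φ) β`; applying `ψ` gives `α
  -- = (r ∘ φ) β` as measures, hence pointwise.
  have h1 : Measure.map φ (α.toMeasure : Measure M) = Measure.map φ
      ((β.toMeasure : Measure M).withDensity fun x => ENNReal.ofReal (α' (φ x) / β' (φ x))) := by
    rw [← hα, toMeasure_eq_withDensity_div α' β', hβ,
      map_withDensity_comp _ hφ.measurable hr.measurable.ennreal_ofReal]
    rfl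
  have h2 := congrArg (Measure.map ψ) h1
  rw [Measure.map_map hψ.measurable hφ.measurable, Measure.map_map hψ.measurable hφ.measurable,
    hψφ.comp_eq_id, Measure.map_id, Measure.map_id,
    toMeasure_withDensity β (r := fun x => α' (φ x) / β' (φ x)) (hr.comp hφ)] at h2
  have h3 := eq_of_withDensity_eq α (β.continuous.mul (hr.comp hφ)) (fun x =>
    mul_nonneg (β.2.1 x).le (div_nonneg (α'.2.1 _).le (β'.2.1 _).le)) h2 x
  rw [h3]
  exact (mul_div_cancel_left₀ _ (β.2.1 x).ne').symm

theorem IsPushforward.comp {φ ψ : M → M} (hφ : Continuous φ) (hψ : Continuous ψ)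
    {α β γ : PosDensity g} (h1 : IsPushforward φ α β) (h2 : IsPushforward ψ β γ) :
    IsPushforward (ψ ∘ φ) α γ := by
  rw [IsPushforward, h2, h1, Measure.map_map hψ.measurable hφ.measurable]

/-- If `α` has a pushforward under the diffeomorphism `h`, so does every density `β`. -/
theorem exists_isPushforward (h : M ≃ₘ^2⟮𝓡 d, 𝓡 d⟯ M) {α α' : PosDensity g}
    (hα : IsPushforward h α α') (β : PosDensity g) : ∃ β' : PosDensity g, IsPushforward h β β' := by
  have hs : ContMDiff (𝓡 d) (𝓡 d) 1 h.symm := h.symm.contMDiff.of_le (by norm_num)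
  -- The known density `α'` already carries the Jacobian of `h`, so that of `h_#β` is `α'` times the
  -- transported quotient `β / α`; no change of variables is needed.
  have hf : ContMDiff (𝓡 d) 𝓘(ℝ, ℝ) 1 fun x => α' x * (β (h.symm x) / α (h.symm x)) :=
    α'.1.contMDiff.mul ((β.1.contMDiff.comp hs).div₀ (α.1.contMDiff.comp hs)
      fun x => (α.2.1 _).ne')
  have hr : Continuous fun x => β (h.symm x) / α (h.symm x) :=
    (β.continuous.comp h.symm.continuous).div (α.continuous.comp h.symm.continuous)
      fun x => (α.2.1 _).ne'
  have hpos (x : M) : 0 < α' x * (β (h.symm x) / α (h.symm x)) :=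
    mul_pos (α'.2.1 x) (div_pos (β.2.1 _) (α.2.1 _))
  have hmap : Measure.map h (β.toMeasure : Measure M) = (riemannianVolume g).withDensity
      fun x => ENNReal.ofReal (α' x * (β (h.symm x) / α (h.symm x))) := by
    rw [← toMeasure_withDensity α' hr, hα, map_withDensity_comp _ h.continuous.measurable
      hr.measurable.ennreal_ofReal, toMeasure_eq_withDensity_div β α]
    congr 2
    funext x
    simp
  have hint : ∫ x, α' x * (β (h.symm x) / α (h.symm x)) ∂(riemannianVolume g) = 1 := by
    have h1 : Measure.map h (β.toMeasure : Measure M) Set.univ = 1 := by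
      rw [Measure.map_apply h.continuous.measurable MeasurableSet.univ, Set.preimage_univ,
        measure_univ]
    rw [hmap, withDensity_apply _ MeasurableSet.univ, Measure.restrict_univ] at h1
    rw [integral_eq_lintegral_of_nonneg_ae (Filter.Eventually.of_forall fun x => (hpos x).le)
      hf.continuous.aestronglyMeasurable, h1, ENNReal.toReal_one]
  exact ⟨⟨⟨_, hf⟩, hpos, hint⟩, hmap.symm⟩

theorem exists_isPushforward_iterate (h : M ≃ₘ^2⟮𝓡 d, 𝓡 d⟯ M) {α α' : PosDensity g}
    (hα : IsPushforward h α α') (j : ℕ) : ∃ β : PosDensity g, IsPushforward h^[j] α β := by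
  induction j with
  | zero => exact ⟨α, by simp [IsPushforward]⟩
  | succ j ih =>
    obtain ⟨β, hβ⟩ := ih
    obtain ⟨γ, hγ⟩ := exists_isPushforward h hα β
    refine ⟨γ, ?_⟩
    rw [Function.iterate_succ']
    exact hβ.comp (h.continuous.iterate j) h.continuous hγ

end PosDensity

end Volume

/-! ### Calculus of directional derivatives -/

section DirectionalDerivative

variable {d : ℕ} {M : Type*} [TopologicalSpace M] [ChartedSpace (EuclideanSpace ℝ (Fin d)) M]

theorem dirDeriv_sub (f : M → ℝ) (x : M) (v w : TangentSpace (𝓡 d) x) :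
    dirDeriv f x (v - w) = dirDeriv f x v - dirDeriv f x w :=
  map_sub (mfderiv (𝓡 d) 𝓘(ℝ, ℝ) f x) v w

theorem dirDeriv_mul {f g : M → ℝ} {x : M} (hf : MDifferentiableAt (𝓡 d) 𝓘(ℝ, ℝ) f x)
    (hg : MDifferentiableAt (𝓡 d) 𝓘(ℝ, ℝ) g x) (v : TangentSpace (𝓡 d) x) :
    dirDeriv (fun x => f x * g x) x v = f x * dirDeriv g x v + g x * dirDeriv f x v := by
  have h := (hf.hasMFDerivAt.mul hg.hasMFDerivAt).mfderiv
  exact DFunLike.congr_fun h v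

theorem dirDeriv_coord {k : ℕ} {Y : M → Fin k → ℝ} {x : M}
    (hY : MDifferentiableAt (𝓡 d) 𝓘(ℝ, Fin k → ℝ) Y x) (i : Fin k) (v : TangentSpace (𝓡 d) x) :
    dirDeriv (fun x => Y x i) x v =
      (show Fin k → ℝ from mfderiv (𝓡 d) 𝓘(ℝ, Fin k → ℝ) Y x v) i := by
  have h := ((ContinuousLinearMap.proj (R := ℝ) (φ := fun _ : Fin k => ℝ) i).hasFDerivAt
    (x := Y x)).hasMFDerivAt.comp x hY.hasMFDerivAt
  exact DFunLike.congr_fun h.mfderiv v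

theorem injective_mfderiv_of_leftInverse {φ ψ : M → M} (hφ : MDifferentiable (𝓡 d) (𝓡 d) φ)
    (hψ : MDifferentiable (𝓡 d) (𝓡 d) ψ) (h : Function.LeftInverse ψ φ) (x : M) :
    Function.Injective (mfderiv (𝓡 d) (𝓡 d) φ x) := by
  have h1 := (hψ (φ x)).hasMFDerivAt.comp x (hφ x).hasMFDerivAt
  rw [h.comp_eq_id] at h1
  have h2 := hasMFDerivAt_unique h1 (hasMFDerivAt_id x)
  intro a b hab
  have h3 (c) : mfderiv (𝓡 d) (𝓡 d) ψ (φ x) (mfderiv (𝓡 d) (𝓡 d) φ x c) = c :=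
    DFunLike.congr_fun h2 c
  have h4 := h3 a
  rw [hab] at h4
  exact h4.symm.trans (h3 b)

theorem contMDiff_smul_section [IsManifold (𝓡 d) ∞ M] {f : M → ℝ}
    (hf : ContMDiff (𝓡 d) 𝓘(ℝ, ℝ) 1 f)
    (v : C1VectorField d M) :
    ContMDiff (𝓡 d) ((𝓡 d).prod 𝓘(ℝ, EuclideanSpace ℝ (Fin d))) 1
      (fun x => (⟨x, f x • v x⟩ : TangentBundle (𝓡 d) M)) :=
  hf.smul_section v.contMDiff

end DirectionalDerivative

/-! ### Separation of fields and diffeomorphisms by quotients of densities -/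

section Separation

variable {d n : ℕ} {M : Type*} [TopologicalSpace M] [ChartedSpace (EuclideanSpace ℝ (Fin d)) M]
  [IsManifold (𝓡 d) ∞ M] [MeasurableSpace M] {g : SmoothMetric d M}

/-- Some quotients of the densities `ρ` are the components of an injective immersion. -/
def HasSeparatingQuotients (ρ : Fin (n + 1) → PosDensity g) : Prop :=
  ∃ (k : ℕ) (a b : Fin k → Fin (n + 1)) (R : M → Fin k → ℝ),
    (∀ x i, R x i = ρ (a i) x / ρ (b i) x) ∧ MDifferentiable (𝓡 d) 𝓘(ℝ, Fin k → ℝ) R ∧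
      Function.Injective R ∧
        ∀ x : M, Function.Injective (mfderiv (𝓡 d) 𝓘(ℝ, Fin k → ℝ) R x)

theorem hasSeparatingQuotients_of_mem_embeddingDensities {ρ : Fin (n + 1) → PosDensity g}
    (hρ : ρ ∈ embeddingDensities g n) : HasSeparatingQuotients ρ :=
  ⟨n, Fin.castSucc, fun _ => Fin.last n, _, fun _ _ => rfl,
    hρ.contMDiff.mdifferentiable one_ne_zero, hρ.injective, hρ.injective_mfderiv⟩

theorem HasSeparatingQuotients.eq_of_divergence_eq {ρ : Fin (n + 1) → PosDensity g}
    (hρ : HasSeparatingQuotients ρ) {v w : C1VectorField d M}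
    (h : ∀ j x, divergence g (fun x => ρ j x • v x) x = divergence g (fun x => ρ j x • w x) x) :
    v = w := by
  obtain ⟨k, a, b, R, hR, hRd, -, hinj⟩ := hρ
  refine ContMDiffSection.ext fun x => ?_
  -- The logarithmic derivative of `ρ j` along `v - w` does not depend on `j`, so it cancels in
  -- quotients.
  have hdiff (j) : dirDeriv (ρ j) x (v x - w x) =
      -(ρ j x * (divergence g v x - divergence g w x)) := by
    have h1 := h j x
    rw [divergence_smul g v.contMDiff (ρ j).1.contMDiff,
      divergence_smul g w.contMDiff (ρ j).1.contMDiff] at h1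
    rw [dirDeriv_sub]
    linarith
  have hcoord (i : Fin k) : dirDeriv (fun x => R x i) x (v x - w x) = 0 := by
    have hRi : MDifferentiableAt (𝓡 d) 𝓘(ℝ, ℝ) (fun x => R x i) x :=
      ((ContinuousLinearMap.proj (R := ℝ) (φ := fun _ : Fin k => ℝ) i).hasFDerivAt
        (x := R x)).hasMFDerivAt.mdifferentiableAt.comp x (hRd x)
    have h1 := dirDeriv_mul hRi ((ρ (b i)).1.contMDiff.mdifferentiable one_ne_zero x) (v x - w x)
    have h2 : (fun x => R x i * ρ (b i) x) = ρ (a i) := by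
      funext y
      rw [hR, div_mul_cancel₀ _ ((ρ (b i)).2.1 y).ne']
    have h3 : ρ (a i) x = R x i * ρ (b i) x := (congrFun h2 x).symm
    rw [h2, hdiff, hdiff, h3] at h1
    have h4 : ρ (b i) x * dirDeriv (fun x => R x i) x (v x - w x) = 0 := by linarith
    exact (mul_eq_zero.1 h4).resolve_left ((ρ (b i)).2.1 x).ne'
  have hzero : mfderiv (𝓡 d) 𝓘(ℝ, Fin k → ℝ) R x (v x - w x) = 0 := by
    refine funext fun i => ?_
    exact (dirDeriv_coord (hRd x) i _).symm.trans (hcoord i)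
  exact sub_eq_zero.1 (hinj x (hzero.trans (map_zero _).symm))

variable [BorelSpace M]

theorem hasSeparatingQuotients_of_takensPair (hm : 2 * d + 1 < n + 1)
    {ρ : Fin (n + 1) → PosDensity g} {h : M ≃ₘ^2⟮𝓡 d, 𝓡 d⟯ M} (hT : TakensPair g (ρ 0) h)
    (hρ : ∀ j : Fin (n + 1), PosDensity.IsPushforward (h^[j]) (ρ 0) (ρ j)) :
    HasSeparatingQuotients ρ := by
  obtain ⟨σ, hσ, hY⟩ := hT
  set Y := delayMap (2 * d + 1) (fun x => ρ 0 x / σ x) h with hYdef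
  have hleft (j : ℕ) : Function.LeftInverse h.symm^[j] h^[j] :=
    Function.LeftInverse.iterate h.symm_apply_apply j
  have hright (j : ℕ) : Function.LeftInverse h^[j] h.symm^[j] :=
    Function.LeftInverse.iterate h.apply_symm_apply j
  have hsmooth : MDifferentiable (𝓡 d) (𝓡 d) h.symm^[2 * d] :=
    (h.symm.contMDiff.iterate _).mdifferentiable (by simp)
  have hsmooth' : MDifferentiable (𝓡 d) (𝓡 d) h^[2 * d] :=
    (h.contMDiff.iterate _).mdifferentiable (by simp)
  have hYd := hY.contMDiff.mdifferentiable one_ne_zero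
  -- Component `i` of the delay map after `h⁻²ᵈ` is `y ∘ h^{-(2d-i)}`, the quotient of the
  -- pushforwards with zero-based indices `2d - i` and `2d - i + 1`. The largest index is `2d + 1`,
  -- which is where `m > 2d + 1` enters.
  refine ⟨2 * d + 1, fun i => ⟨2 * d - i, by omega⟩, fun i => ⟨2 * d - i + 1, by omega⟩,
    Y ∘ h.symm^[2 * d], fun x i => ?_, hYd.comp hsmooth,
    hY.injective.comp (hright _).injective, fun x => ?_⟩
  · obtain ⟨z, rfl⟩ := (hright (2 * d)).surjective x
    have h1 : h^[2 * d] z = h^[2 * d - i] (h^[i] z) := by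
      rw [← Function.iterate_add_apply, Nat.sub_add_cancel (by omega)]
    -- As `σ = h_#ρ₁`, it lies one step ahead in the orbit of densities.
    have h2 : PosDensity.IsPushforward (h^[2 * d - i]) σ (ρ ⟨2 * d - i + 1, by omega⟩) := by
      have h3 := hρ ⟨2 * d - i + 1, by omega⟩
      rw [PosDensity.IsPushforward] at hσ h3 ⊢
      rw [h3, hσ, Measure.map_map (h.continuous.iterate _).measurable h.continuous.measurable]
      rfl
    have h4 := (hρ ⟨2 * d - i, by omega⟩).div_comp (h.continuous.iterate _)
      (h.symm.continuous.iterate _) (hleft _) h2 (h^[i] z)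
    rw [Function.comp_apply, hleft, h1]
    exact h4.symm
  · rw [mfderiv_comp x (hYd _) (hsmooth x)]
    exact (hY.injective_mfderiv _).comp
      (injective_mfderiv_of_leftInverse hsmooth hsmooth' (hright _) x)

theorem HasSeparatingQuotients.eq_of_pushProb_eq {N : Type*} [TopologicalSpace N]
    [ChartedSpace (EuclideanSpace ℝ (Fin d)) N] [MeasurableSpace N] [BorelSpace N]
    {ρ : Fin (n + 1) → PosDensity g} (hρ : HasSeparatingQuotients ρ)
    {f₁ f₂ : M ≃ₘ^1⟮𝓡 d, 𝓡 d⟯ N}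
    (h : ∀ j, pushProb f₁ (ρ j).toMeasure = pushProb f₂ (ρ j).toMeasure) : f₁ = f₂ := by
  obtain ⟨k, a, b, R, hR, -, hinj, -⟩ := hρ
  -- Equal images on `N` become invariance of each density under one self-map of `M`.
  have hpush (j : Fin (n + 1)) : PosDensity.IsPushforward (f₂.symm ∘ f₁) (ρ j) (ρ j) := by
    have h1 : Measure.map f₁ ((ρ j).toMeasure : Measure M) =
        Measure.map f₂ ((ρ j).toMeasure : Measure M) :=
      congrArg ProbabilityMeasure.toMeasure (h j)
    have h2 : f₂.symm ∘ f₂ = id := funext f₂.symm_apply_apply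
    rw [PosDensity.IsPushforward, ← Measure.map_map f₂.symm.continuous.measurable
      f₁.continuous.measurable, h1, Measure.map_map f₂.symm.continuous.measurable
      f₂.continuous.measurable, h2, Measure.map_id]
  refine Diffeomorph.ext fun x => ?_
  have h3 : R ((f₂.symm ∘ f₁) x) = R x := by
    funext i
    rw [hR, hR]
    exact (hpush (a i)).div_comp (ψ := f₁.symm ∘ f₂) (f₂.symm.continuous.comp f₁.continuous)
      (f₁.symm.continuous.comp f₂.continuous) (fun y => by simp) (hpush (b i)) x
  have h4 : f₂.symm (f₁ x) = x := hinj h3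
  rw [← f₂.apply_symm_apply (f₁ x), h4]

end Separation
end PushforwardMetrics

end

/-! ### The main theorem -/

open PushforwardMetrics in
theorem corollary1 (d n : ℕ) (hm : 2 * d + 1 < n + 1)
    {M : Type*} [TopologicalSpace M] [ChartedSpace (EuclideanSpace ℝ (Fin d)) M]
    [IsManifold (𝓡 d) ∞ M] [CompactSpace M] [T2Space M] [MeasurableSpace M] [BorelSpace M]
    {N : Type*} [TopologicalSpace N] [ChartedSpace (EuclideanSpace ℝ (Fin d)) N]
    [IsManifold (𝓡 d) ∞ N] [CompactSpace N] [T2Space N] [MeasurableSpace N] [BorelSpace N]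
    (g : SmoothMetric d M)
    (𝒟 : ProbabilityMeasure N → ProbabilityMeasure N → ℝ) (h𝒟 : IsMetric 𝒟)
    (δ : C(M, ℝ) → C(M, ℝ) → ℝ) (hδ : IsMetric δ) :
    (∀ ρ : Fin (n + 1) → PosDensity g,
      (ρ ∈ embeddingDensities g n ∨
        ∃ h : M ≃ₘ^2⟮𝓡 d, 𝓡 d⟯ M, TakensPair g (ρ 0) h ∧
          ∀ j : Fin (n + 1), PosDensity.IsPushforward (h^[j]) (ρ 0) (ρ j)) →
      IsMetric (fun f₁ f₂ : M ≃ₘ^1⟮𝓡 d, 𝓡 d⟯ N =>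
        ∑ j, 𝒟 (pushProb f₁ (ρ j).toMeasure) (pushProb f₂ (ρ j).toMeasure)) ∧
      ∃ hdiv : ∀ (j : Fin (n + 1)) (v : C1VectorField d M),
          Continuous (divergence g fun x => ρ j x • v x),
        IsMetric (fun v w : C1VectorField d M =>
          ∑ j, δ ⟨divergence g fun x => ρ j x • v x, hdiv j v⟩
            ⟨divergence g fun x => ρ j x • w x, hdiv j w⟩)) ∧
    (∀ (ρ₁ : PosDensity g) (h : M ≃ₘ^2⟮𝓡 d, 𝓡 d⟯ M), TakensPair g ρ₁ h →
      ∃! ρ : Fin (n + 1) → PosDensity g,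
        ∀ j : Fin (n + 1), PosDensity.IsPushforward (h^[j]) ρ₁ (ρ j)) := by
  refine ⟨fun ρ hρ => ?_, fun ρ₁ h ⟨σ, hσ, _⟩ => ?_⟩
  · have hsep : HasSeparatingQuotients ρ := by
      rcases hρ with hρ | ⟨h, hT, hρ⟩
      · exact hasSeparatingQuotients_of_mem_embeddingDensities hρ
      · exact hasSeparatingQuotients_of_takensPair hm hT hρ
    have hdiv (j : Fin (n + 1)) (v : C1VectorField d M) :
        Continuous (divergence g fun x => ρ j x • v x) :=
      continuous_divergence g (contMDiff_smul_section (ρ j).1.contMDiff v)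
    refine ⟨h𝒟.sum_comp (F := fun j f => pushProb f (ρ j).toMeasure)
      fun f₁ f₂ h => hsep.eq_of_pushProb_eq h, hdiv, ?_⟩
    exact hδ.sum_comp (F := fun (j : Fin (n + 1)) (v : C1VectorField d M) =>
        (ContinuousMap.mk (divergence g fun x => ρ j x • v x) (hdiv j v) : C(M, ℝ)))
      fun v w h => hsep.eq_of_divergence_eq fun j x => DFunLike.congr_fun (h j) x
  · choose ρ hρ using fun j : Fin (n + 1) => PosDensity.exists_isPushforward_iterate h hσ j
    exact ⟨ρ, hρ, fun ρ' hρ' => funext fun j =>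
      PosDensity.ext_of_toMeasure_eq ((hρ' j).trans (hρ j).symm)⟩
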